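/- Let $n\ge 1$ be an integer, $s\in\mathbb R$, $\mu_s(x)=(1+|x|^2)^{s/2}$, and $\mathbb T^n=[-\tfrac12,\tfrac12)^n$. Let $H^s=\{f\in\mathcal S'(\mathbb R^n):\mu_s\widehat f\in L^2\}$ with $\langle f,g\rangle_{H^s}=\int_{\mathbb R^n}\widehat f\,\overline{\widehat g}\,\mu_s^2$, where $\widehat f(t)=\int f(x)e^{-2\pi i\langle x,t\rangle}\,dx$, and let $\ell^2_s$ be the Hilbert space of sequences on $\mathbb Z^n$ with $\langle c,d\rangle_{\ell_s^2}=\sum_{k}c_k\overline{d_k}\,\mu_s^2(k)$. For $f\in H^s$ set $$\mathcal T_sf(t)=\Big(\frac{\mu_s(t+k)\widehat f(t+k)}{\mu_s(k)}\Big)_{k\in\mathbb Z^n}\in\ell^2_s\quad\text{for a.e. }t\in\mathbb T^n .$$ Let $T_kf=f(\cdot-k)$, and let $V_s\subseteq H^s$ be a closed shift-invariant subspace (i.e. $T_kV_s\subseteq V_s$ for all $k\in\mathbb Z^n$). Let $J_s$ be the associated range function, that is, a map from $\mathbb T^n$ to the closed subspaces of $\ell^2_s$ such that $t\mapsto\langle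 P_{J_s(t)}a,b\rangle$ is measurable for all $a,b\in\ell_s^2$ ($P_{J_s(t)}$ being the orthogonal projection onto $J_s(t)$) and $V_s=\{f\in H^s:\mathcal T_sf(t)\in J_s(t)\text{ for a.e. }t\in\mathbb T^n\}$. A bounded linear operator $M:V_s\to H^s$ is shift-preserving if $MT_k=T_kM$ on $V_s$ for all $k\in\mathbb Z^n$; a range operator corresponding to $M$ is a family of bounded operators $Q(t):J_s(t)\to\ell_s^2$ $(t\in\mathbb T^n)$ such that $t\mapsto\langle Q(t)P_{J_s(t)}a,b\rangle$ is measurable for all $a,b\in\ell^2_s$ and, for every $f\in V_s$, $\mathcal T_s(Mf)(t)=Q(t)(\mathcal T_sf(t))$ for a.e. $t\in\mathbb T^n$. Let $L:V_s\to V_s$ be a shift-preserving bounded linear operator with corresponding range operator $R_s$. Then, for a.e. $t\in\mathbb T^n$, $R_s(t)$ maps $J_s(t)$ into $J_s(t)$, so that it is a bounded operator on the Hilbert space $J_s(t)$, and: 1. The adjoint $L^*:V_s\to V_s$ is shift-preserving, with corresponding range operator $t\mapsto R_s(t)^*$ (the adjoint being taken in $J_s(t)$). 2. For all real $A\le B$: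 $L$ is self-adjoint with $\sigma(L)\subseteq[A,B]$ if and only if, for a.e. $t\in\mathbb T^n$, $R_s(t)$ is self-adjoint on $J_s(t)$ with $\sigma(R_s(t))\subseteq[A,B]$. 3. $L$ is unitary on $V_s$ if and only if $R_s(t)$ is unitary on $J_s(t)$ for a.e. $t\in\mathbb T^n$. -/

import Mathlib

open MeasureTheory FourierTransform TemperedDistribution
open scoped SchwartzMap ENNReal

noncomputable section

namespace SISobolev

/-- `ℝⁿ` with the Euclidean norm. -/
abbrev Rn (n : ℕ) : Type := EuclideanSpace ℝ (Fin n)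

/-- `ℤⁿ`. -/
abbrev Zn (n : ℕ) : Type := Fin n → ℤ

/-- The inclusion `ℤⁿ ⊂ ℝⁿ`. -/
def latticePt {n : ℕ} (k : Zn n) : Rn n := WithLp.toLp 2 fun i => (k i : ℝ)

/-- The weight `μ_s(x) = (1 + |x|²)^{s/2}`. -/
def weight {n : ℕ} (s : ℝ) (x : Rn n) : ℝ := (1 + ‖x‖ ^ 2) ^ (s / 2)

theorem weight_pos {n : ℕ} (s : ℝ) (x : Rn n) : 0 < weight s x := by
  unfold weight; positivity

theorem weight_ne_zero {n : ℕ} (s : ℝ) (x : Rn n) : (weight s x : ℂ) ≠ 0 :=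
  Complex.ofReal_ne_zero.mpr (weight_pos s x).ne'

/-- The fundamental cell `𝕋ⁿ = [-1/2, 1/2)ⁿ`. -/
def cell (n : ℕ) : Set (Rn n) := {t | ∀ i, -(1 / 2 : ℝ) ≤ t i ∧ t i < 1 / 2}

/-- Lebesgue measure on `𝕋ⁿ`. -/
abbrev cellMeasure (n : ℕ) : Measure (Rn n) := volume.restrict (cell n)

section Transport

variable {X H : Type*} [AddCommGroup X] [Module ℂ X] [NormedAddCommGroup H]
  [InnerProductSpace ℂ H]

/-- The norm on `X` that makes a linear bijection onto a normed space isometric. -/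
abbrev normedOfEquiv (e : X ≃ₗ[ℂ] H) : NormedAddCommGroup X :=
  NormedAddCommGroup.induced X H e e.injective

/-- The inner product on `X` that makes a linear bijection onto an inner product space
isometric. -/
abbrev innerOfEquiv (e : X ≃ₗ[ℂ] H) :
    @InnerProductSpace ℂ X _ (normedOfEquiv e).toSeminormedAddCommGroup :=
  letI := normedOfEquiv e
  { NormedSpace.induced ℂ X H e with
    inner := fun x y => inner ℂ (e x) (e y)
    norm_sq_eq_re_inner := fun x => norm_sq_eq_re_inner (𝕜 := ℂ) (e x)
    conj_inner_symm := fun x y => inner_conj_symm (e x) (e y)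
    add_left := fun x y z => by simp
    smul_left := fun x y r => by simp [mul_comm] }

theorem completeOfEquiv [CompleteSpace H] (e : X ≃ₗ[ℂ] H) :
    @CompleteSpace X (normedOfEquiv e).toMetricSpace.toUniformSpace := by
  let _ := normedOfEquiv e
  have hi : Isometry e := AddMonoidHomClass.isometry_of_norm e (fun _ => rfl)
  exact (completeSpace_congr (e := e.toEquiv) hi.isUniformEmbedding).mpr inferInstance

end Transport

/-! ### The weighted sequence space `ℓ²_s(ℤⁿ)` -/

/-- The sequences `c` on `ℤⁿ` with `(c_k μ_s(k))_k ∈ ℓ²`. -/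
def seqSubmodule (n : ℕ) (s : ℝ) : Submodule ℂ (Zn n → ℂ) where
  carrier := {c | Memℓp (fun k => (weight s (latticePt k) : ℂ) * c k) 2}
  add_mem' := fun {a b} ha hb => by
    have h := Memℓp.add ha hb
    have e : (fun k => (weight s (latticePt k) : ℂ) * (a + b) k) =
        (fun k => (weight s (latticePt k) : ℂ) * a k) +
          fun k => (weight s (latticePt k) : ℂ) * b k := by
      funext k; simp [mul_add]
    simpa only [Set.mem_ofPred_eq, e] using h
  zero_mem' := by
    have h : Memℓp (0 : Zn n → ℂ) 2 := zero_memℓp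
    have e : (fun k : Zn n => (weight s (latticePt k) : ℂ) * (0 : Zn n → ℂ) k) = 0 := by
      funext k; simp
    simpa only [Set.mem_ofPred_eq, e] using h
  smul_mem' := fun r a ha => by
    have h := Memℓp.const_smul ha r
    have e : (fun k => (weight s (latticePt k) : ℂ) * (r • a) k) =
        r • fun k => (weight s (latticePt k) : ℂ) * a k := by
      funext k; simp [mul_left_comm]
    simpa only [Set.mem_ofPred_eq, e] using h

/-- The space `ℓ²_s(ℤⁿ)`. -/
def SeqSpace (n : ℕ) (s : ℝ) : Type := seqSubmodule n s

instance (n : ℕ) (s : ℝ) : AddCommGroup (SeqSpace n s) :=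
  inferInstanceAs (AddCommGroup (seqSubmodule n s))

instance (n : ℕ) (s : ℝ) : Module ℂ (SeqSpace n s) :=
  inferInstanceAs (Module ℂ (seqSubmodule n s))

/-- The sequence underlying an element of `ℓ²_s(ℤⁿ)`. -/
def SeqSpace.val {n : ℕ} {s : ℝ} (c : SeqSpace n s) : Zn n → ℂ :=
  ((show seqSubmodule n s from c) : Zn n → ℂ)

/-- The bijection `c ↦ (c_k μ_s(k))_k` from `ℓ²_s(ℤⁿ)` onto `ℓ²(ℤⁿ)`. -/
def SeqSpace.toL2 (n : ℕ) (s : ℝ) : SeqSpace n s ≃ₗ[ℂ] lp (fun _ : Zn n => ℂ) 2 where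
  toFun c := ⟨fun k => (weight s (latticePt k) : ℂ) * c.val k, c.2⟩
  map_add' a b := by
    ext k
    exact mul_add _ (a.val k) (b.val k)
  map_smul' r a := by
    ext k
    exact mul_left_comm _ r (a.val k)
  invFun d := ⟨fun k => (weight s (latticePt k) : ℂ)⁻¹ * d k, by
    have h := lp.memℓp d
    have e : (fun k => (weight s (latticePt k) : ℂ) *
        ((weight s (latticePt k) : ℂ)⁻¹ * d k)) = d := by
      funext k
      exact mul_inv_cancel_left₀ (weight_ne_zero s _) _
    change Memℓp (fun k => (weight s (latticePt k) : ℂ) *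
        ((weight s (latticePt k) : ℂ)⁻¹ * d k)) 2
    rw [e]
    exact h⟩
  left_inv c := by
    apply Subtype.ext
    funext k
    exact inv_mul_cancel_left₀ (weight_ne_zero s _) _
  right_inv d := by
    ext k
    exact mul_inv_cancel_left₀ (weight_ne_zero s _) _

instance (n : ℕ) (s : ℝ) : NormedAddCommGroup (SeqSpace n s) :=
  normedOfEquiv (SeqSpace.toL2 n s)

/-- `⟨c, d⟩ = ∑_k c_k conj(d_k) μ_s(k)²` (in Mathlib's convention the conjugate falls on the
first argument of `inner`). -/
instance (n : ℕ) (s : ℝ) : InnerProductSpace ℂ (SeqSpace n s) :=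
  innerOfEquiv (SeqSpace.toL2 n s)

instance (n : ℕ) (s : ℝ) : CompleteSpace (SeqSpace n s) :=
  completeOfEquiv (SeqSpace.toL2 n s)

/-! ### The Sobolev space `Hˢ(ℝⁿ)` -/

/-- The tempered distributions that belong to `Hˢ(ℝⁿ)`. -/
def sobolevSubmodule (n : ℕ) (s : ℝ) : Submodule ℂ 𝓢'(Rn n, ℂ) where
  carrier := {f | MemSobolev s 2 f}
  add_mem' := MemSobolev.add
  zero_mem' := memSobolev_fun_zero _ _ s 2
  smul_mem' := fun c _ hf => hf.smul c

/-- The space `Hˢ(ℝⁿ)`. It is kept apart from the submodule of `𝓢'(ℝⁿ)` because it carries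
its own norm instead of the topology of `𝓢'(ℝⁿ)`. -/
def Sobolev (n : ℕ) (s : ℝ) : Type := sobolevSubmodule n s

instance (n : ℕ) (s : ℝ) : AddCommGroup (Sobolev n s) :=
  inferInstanceAs (AddCommGroup (sobolevSubmodule n s))

instance (n : ℕ) (s : ℝ) : Module ℂ (Sobolev n s) :=
  inferInstanceAs (Module ℂ (sobolevSubmodule n s))

/-- The tempered distribution underlying an element of `Hˢ(ℝⁿ)`. -/
def Sobolev.dist {n : ℕ} {s : ℝ} : Sobolev n s →ₗ[ℂ] 𝓢'(Rn n, ℂ) :=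
  (sobolevSubmodule n s).subtype

/-- The map that sends `u ∈ L²(ℝⁿ)` to the `f ∈ Hˢ(ℝⁿ)` with `μ_s 𝓕 f = u`. -/
def Sobolev.ofWeightedFourier (n : ℕ) (s : ℝ) :
    Lp ℂ 2 (volume : Measure (Rn n)) →ₗ[ℂ] Sobolev n s :=
  LinearMap.codRestrict (sobolevSubmodule n s)
    ((besselPotential (Rn n) ℂ (-s) ∘L Lp.toTemperedDistributionCLM ℂ volume 2 ∘L
      fourierInvCLM ℂ (Lp ℂ 2 (volume : Measure (Rn n)))).toLinearMap)
    (fun u => ⟨𝓕⁻ u, by simp⟩)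

theorem Sobolev.smul_fourier_ofWeightedFourier {n : ℕ} {s : ℝ}
    (u : Lp ℂ 2 (volume : Measure (Rn n))) :
    smulLeftCLM ℂ (fun x => (weight s x : ℂ)) (𝓕 (Sobolev.ofWeightedFourier n s u).dist) =
      (u : 𝓢'(Rn n, ℂ)) := by
  have h : besselPotential (Rn n) ℂ s (Sobolev.ofWeightedFourier n s u).dist =
      ((𝓕⁻ u : Lp ℂ 2 (volume : Measure (Rn n))) : 𝓢'(Rn n, ℂ)) := by
    change besselPotential (Rn n) ℂ s (besselPotential (Rn n) ℂ (-s)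
      ((𝓕⁻ u : Lp ℂ 2 (volume : Measure (Rn n))) : 𝓢'(Rn n, ℂ))) = _
    simp
  have h' := congrArg (fun g : 𝓢'(Rn n, ℂ) => 𝓕 g) h
  simp only [fourier_besselPotential_eq_smulLeftCLM_fourier_apply,
    Lp.fourier_toTemperedDistribution_eq, fourier_fourierInv_eq] at h'
  exact h'

theorem Sobolev.ofWeightedFourier_bijective (n : ℕ) (s : ℝ) :
    Function.Bijective (Sobolev.ofWeightedFourier n s) := by
  constructor
  · intro u v huv
    have h : (u : 𝓢'(Rn n, ℂ)) = (v : 𝓢'(Rn n, ℂ)) := by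
      rw [← Sobolev.smul_fourier_ofWeightedFourier (s := s) u, huv,
        Sobolev.smul_fourier_ofWeightedFourier]
    exact (LinearMap.ker_eq_bot.mp (Lp.ker_toTemperedDistributionCLM_eq_bot (F := ℂ)
      (μ := (volume : Measure (Rn n))) (p := 2))) h
  · rintro ⟨f, g, hg⟩
    refine ⟨𝓕 g, Subtype.ext ?_⟩
    change besselPotential (Rn n) ℂ (-s)
      ((𝓕⁻ (𝓕 g) : Lp ℂ 2 (volume : Measure (Rn n))) : 𝓢'(Rn n, ℂ)) = f
    rw [fourierInv_fourier_eq, ← hg]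
    simp

/-- The bijection `f ↦ μ_s 𝓕 f` from `Hˢ(ℝⁿ)` onto `L²(ℝⁿ)`. -/
def Sobolev.weightedFourier (n : ℕ) (s : ℝ) :
    Sobolev n s ≃ₗ[ℂ] Lp ℂ 2 (volume : Measure (Rn n)) :=
  (LinearEquiv.ofBijective _ (Sobolev.ofWeightedFourier_bijective n s)).symm

theorem Sobolev.weightedFourier_spec {n : ℕ} {s : ℝ} (f : Sobolev n s) :
    smulLeftCLM ℂ (fun x => (weight s x : ℂ)) (𝓕 f.dist) =
      (Sobolev.weightedFourier n s f : 𝓢'(Rn n, ℂ)) := by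
  conv_lhs => rw [← (Sobolev.weightedFourier n s).symm_apply_apply f]
  exact Sobolev.smul_fourier_ofWeightedFourier _

instance (n : ℕ) (s : ℝ) : NormedAddCommGroup (Sobolev n s) :=
  normedOfEquiv (Sobolev.weightedFourier n s)

/-- `⟨f, g⟩ = ∫ 𝓕f conj(𝓕g) μ_s²` (in Mathlib's convention the conjugate falls on the first
argument of `inner`). -/
instance (n : ℕ) (s : ℝ) : InnerProductSpace ℂ (Sobolev n s) :=
  innerOfEquiv (Sobolev.weightedFourier n s)

instance (n : ℕ) (s : ℝ) : CompleteSpace (Sobolev n s) :=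
  completeOfEquiv (Sobolev.weightedFourier n s)

/-! ### Translations -/

/-- The translation `f ↦ f(· - a)` of tempered distributions: `(T_a f)(φ) = f(φ(· + a))`. -/
def translateDist {n : ℕ} (a : Rn n) : 𝓢'(Rn n, ℂ) →L[ℂ] 𝓢'(Rn n, ℂ) :=
  PointwiseConvergenceCLM.precomp ℂ (SchwartzMap.compSubConstCLM ℂ (-a))

theorem fourierInv_compSubConst {n : ℕ} (b : Rn n) (φ : 𝓢(Rn n, ℂ)) (x : Rn n) :
    𝓕⁻ (SchwartzMap.compSubConstCLM ℂ b φ) x =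
      Complex.exp (2 * Real.pi * inner ℝ b x * Complex.I) * 𝓕⁻ φ x := by
  rw [SchwartzMap.fourierInv_coe, SchwartzMap.fourierInv_coe, Real.fourierInv_eq',
    Real.fourierInv_eq']
  simp only [SchwartzMap.compSubConstCLM_apply]
  rw [← integral_add_right_eq_self _ b, ← integral_const_mul]
  congr 1
  funext v
  simp only [add_sub_cancel_right, smul_eq_mul, inner_add_left]
  rw [← mul_assoc, ← Complex.exp_add]
  congr 2
  push_cast
  ring

theorem translateDist_mem {n : ℕ} {s : ℝ} (a : Rn n) {f : 𝓢'(Rn n, ℂ)}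
    (hf : MemSobolev s 2 f) : MemSobolev s 2 (translateDist a f) := by
  obtain ⟨g, hg⟩ := hf
  have hcomm : ∀ φ : 𝓢(Rn n, ℂ),
      SchwartzMap.compSubConstCLM ℂ (-a) (𝓕 (SchwartzMap.smulLeftCLM ℂ
        (fun x : Rn n => (((1 + ‖x‖ ^ 2) ^ (s / 2) : ℝ) : ℂ)) (𝓕⁻ φ))) =
      𝓕 (SchwartzMap.smulLeftCLM ℂ (fun x : Rn n => (((1 + ‖x‖ ^ 2) ^ (s / 2) : ℝ) : ℂ))
        (𝓕⁻ (SchwartzMap.compSubConstCLM ℂ (-a) φ))) := by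
    intro φ
    have h : ∀ ψ χ : 𝓢(Rn n, ℂ), 𝓕⁻ ψ = 𝓕⁻ χ → ψ = χ := fun ψ χ h => by
      simpa using congrArg (fun η : 𝓢(Rn n, ℂ) => (𝓕 η : 𝓢(Rn n, ℂ))) h
    apply h
    ext x
    rw [fourierInv_compSubConst, fourierInv_fourier_eq, fourierInv_fourier_eq,
      SchwartzMap.smulLeftCLM_apply_apply (by fun_prop),
      SchwartzMap.smulLeftCLM_apply_apply (by fun_prop), fourierInv_compSubConst]
    simp only [smul_eq_mul]
    ring
  have hmp : MeasurePreserving (fun x : Rn n => x - a) volume volume :=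
    measurePreserving_sub_right volume a
  refine ⟨Lp.compMeasurePreserving (fun x : Rn n => x - a) hmp g, ?_⟩
  ext φ
  have h1 : besselPotential (Rn n) ℂ s (translateDist a f) φ =
      besselPotential (Rn n) ℂ s f (SchwartzMap.compSubConstCLM ℂ (-a) φ) :=
    congrArg f (hcomm φ)
  rw [h1, hg, Lp.toTemperedDistribution_apply, Lp.toTemperedDistribution_apply,
    ← integral_sub_right_eq_self _ a]
  apply integral_congr_ae
  filter_upwards [Lp.coeFn_compMeasurePreserving g hmp] with x hx
  rw [hx]
  simp

/-- The translation `T_k f = f(· - k)`, `k ∈ ℤⁿ`, on `Hˢ(ℝⁿ)`. -/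
def shift {n : ℕ} {s : ℝ} (k : Zn n) : Sobolev n s →ₗ[ℂ] Sobolev n s :=
  LinearMap.codRestrict (sobolevSubmodule n s)
    ((translateDist (latticePt k)).toLinearMap ∘ₗ Sobolev.dist)
    (fun f => translateDist_mem (latticePt k) f.2)

/-! ### The fiberization `𝒯_s` -/

open Classical in
/-- The fiber map `𝒯_s`. For `f = (1 - Δ/4π²)^{-s/2} g` with `g ∈ L²`, it is
`𝒯_s f(t) = (𝓕 g(t + k) / μ_s(k))_k`, where `𝓕 g = μ_s 𝓕 f`. This sequence lies in `ℓ²_s` for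
a.e. `t ∈ 𝕋ⁿ`; on the exceptional null set the value is irrelevant and set to `0`. -/
def fiber {n : ℕ} {s : ℝ} (f : Sobolev n s) (t : Rn n) : SeqSpace n s :=
  if h : (fun k : Zn n => Sobolev.weightedFourier n s f (t + latticePt k) /
      (weight s (latticePt k) : ℂ)) ∈ seqSubmodule n s
  then ⟨_, h⟩ else 0

/-! ### Shift-invariant spaces, range functions, shift-preserving and range operators -/

instance {H : Type*} [NormedAddCommGroup H] [InnerProductSpace ℂ H] [CompleteSpace H]
    (K : ClosedSubmodule ℂ H) : CompleteSpace K.toSubmodule :=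
  K.isClosed.completeSpace_coe

/-- `V` is shift-invariant. -/
def IsShiftInvariant {n : ℕ} {s : ℝ} (V : ClosedSubmodule ℂ (Sobolev n s)) : Prop :=
  ∀ (k : Zn n) (f : Sobolev n s), f ∈ V → shift k f ∈ V

/-- A range function: closed subspaces of `ℓ²_s` indexed by `𝕋ⁿ`. Its values outside `𝕋ⁿ`
play no role. -/
abbrev RangeFunction (n : ℕ) (s : ℝ) : Type := Rn n → ClosedSubmodule ℂ (SeqSpace n s)

/-- Measurability of a range function: the orthogonal projections `P(t)` onto `J(t)` are weakly
(Lebesgue) measurable on `𝕋ⁿ`. -/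
def RangeFunction.IsMeasurable {n : ℕ} {s : ℝ} (J : RangeFunction n s) : Prop :=
  ∀ a b : SeqSpace n s,
    AEMeasurable (fun t => inner ℂ ((J t).toSubmodule.starProjection a) b) (cellMeasure n)

/-- `J` is the measurable range function associated with `V`:
`V = {f ∈ Hˢ : 𝒯_s f(t) ∈ J(t) for a.e. t ∈ 𝕋ⁿ}`. -/
def IsRangeFunctionOf {n : ℕ} {s : ℝ} (V : ClosedSubmodule ℂ (Sobolev n s))
    (J : RangeFunction n s) : Prop :=
  J.IsMeasurable ∧ ∀ f : Sobolev n s, f ∈ V ↔ ∀ᵐ t ∂cellMeasure n, fiber f t ∈ J t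

/-- A bounded operator `L : V → Hˢ` is shift-preserving if `L T_k = T_k L` for all `k ∈ ℤⁿ`. -/
def IsShiftPreserving {n : ℕ} {s : ℝ} {V : ClosedSubmodule ℂ (Sobolev n s)}
    (L : V.toSubmodule →L[ℂ] Sobolev n s) : Prop :=
  ∀ (k : Zn n) (f : V.toSubmodule) (h : shift k (f : Sobolev n s) ∈ V.toSubmodule),
    L ⟨shift k (f : Sobolev n s), h⟩ = shift k (L f)

/-- A range operator on `J` with values in `ℓ²_s`. -/
abbrev RangeOperator {n : ℕ} {s : ℝ} (J : RangeFunction n s) : Type :=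
  (t : Rn n) → (J t).toSubmodule →L[ℂ] SeqSpace n s

/-- Measurability of a range operator: the operators `R(t) P(t)` are weakly (Lebesgue)
measurable on `𝕋ⁿ`. -/
def RangeOperator.IsMeasurable {n : ℕ} {s : ℝ} {J : RangeFunction n s}
    (R : RangeOperator J) : Prop :=
  ∀ a b : SeqSpace n s,
    AEMeasurable (fun t => inner ℂ (R t ((J t).toSubmodule.orthogonalProjectionOnto a)) b)
      (cellMeasure n)

/-- `R` is the range operator corresponding to `L`: it is measurable and, for every `f ∈ V`,
`𝒯_s (L f)(t) = R(t) (𝒯_s f(t))` for a.e. `t ∈ 𝕋ⁿ`. -/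
def IsRangeOperatorOf {n : ℕ} {s : ℝ} {V : ClosedSubmodule ℂ (Sobolev n s)}
    {J : RangeFunction n s} (L : V.toSubmodule →L[ℂ] Sobolev n s) (R : RangeOperator J) : Prop :=
  R.IsMeasurable ∧ ∀ f : V.toSubmodule, ∀ᵐ t ∂cellMeasure n,
    ∃ h : fiber (f : Sobolev n s) t ∈ (J t).toSubmodule,
      fiber (L f) t = R t ⟨fiber (f : Sobolev n s) t, h⟩

/-- The range operator at `t` regarded as an operator `J(t) → J(t)`. If `R(t)` maps `J(t)` into
itself, this is `R(t)` with codomain restricted to `J(t)`; the orthogonal projection only makes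
the definition total. -/
def RangeOperator.onFiber {n : ℕ} {s : ℝ} {J : RangeFunction n s} (R : RangeOperator J)
    (t : Rn n) : (J t).toSubmodule →L[ℂ] (J t).toSubmodule :=
  (J t).toSubmodule.orthogonalProjectionOnto ∘L R t

end SISobolev

end

open SISobolev

/-! Since the norm of `Sobolev n s` is the L² norm of the weighted Fourier transform, and the
lattice translates of the cell tile ℝⁿ, the fiberization is an isometry (`fiberL2`) into L²(𝕋ⁿ;
ℓ²_s). It is also onto (`exists_fiber_ae_eq`). In this picture V consists of the square-integrable
sections of J, and L acts as the field of operators R(t), a relation abstracted as `ActsFiberwise`.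

Two devices move statements between L and its fibers. Sections may be cut off by indicators of
measurable sets (`exists_indicator`), and L commutes with the cutoff (`ae_eq_indicator`), so an
identity or inequality between integrals localizes to almost every t. Countably many sections are
dense in J(t) for a.e. t (`exists_dense_sections`), so countably many a.e. statements together
control every vector of J(t).

Adjoints, equality and positivity therefore hold for L exactly when they hold fiberwise a.e.
Unitarity is the pair of equations L*L = 1 = LL*. A spectrum in [A, B] together with
self-adjointness is the pair of inequalities A ≤ L ≤ B, so no spectrum of a field of operators has
to be computed. That L* is shift-preserving comes from T_k being unitary with adjoint T_{-k}. -/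

noncomputable section

namespace SISobolev

/-! ### Tiling `ℝⁿ` by the lattice translates of the cell -/

/-- The lattice point `k` with `x ∈ 𝕋ⁿ + k`. -/
def cellIndex {n : ℕ} (x : Rn n) : Zn n := fun i => ⌊x i + 1 / 2⌋

@[simp]
theorem latticePt_apply {n : ℕ} (k : Zn n) (i : Fin n) : latticePt k i = (k i : ℝ) := rfl

theorem cellIndex_eq_iff {n : ℕ} (t : Rn n) (k : Zn n) :
    cellIndex (t + latticePt k) = k ↔ t ∈ cell n := by
  simp only [cellIndex, funext_iff, cell, Set.mem_ofPred_eq, PiLp.add_apply, latticePt_apply,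
    Int.floor_eq_iff]
  refine forall_congr' fun i => ?_
  constructor <;> rintro ⟨h₁, h₂⟩ <;> constructor <;> linarith

theorem measurable_cellIndex {n : ℕ} : Measurable (cellIndex : Rn n → Zn n) :=
  measurable_pi_lambda _ fun i => by
    have : Measurable fun x : Rn n => x i + 1 / 2 := by fun_prop
    exact Int.measurable_floor.comp this

theorem measurable_latticePt {n : ℕ} : Measurable (latticePt : Zn n → Rn n) :=
  Measurable.of_discrete

theorem measurableSet_cell (n : ℕ) : MeasurableSet (cell n) := by
  have h : cell n = cellIndex ⁻¹' {(0 : Zn n)} := by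
    ext t
    have : latticePt (0 : Zn n) = 0 := by ext i; simp
    rw [← cellIndex_eq_iff t 0, this, add_zero]; rfl
  rw [h]
  exact measurable_cellIndex (measurableSet_singleton _)

instance isFiniteMeasure_cellMeasure (n : ℕ) : IsFiniteMeasure (cellMeasure n) := by
  refine ⟨?_⟩
  rw [Measure.restrict_apply_univ]
  have hb : Bornology.IsBounded (WithLp.toLp 2 ''
      Set.Icc (fun _ : Fin n => -(1 / 2 : ℝ)) (fun _ => 1 / 2)) :=
    (isCompact_Icc.image (PiLp.continuous_toLp 2 _)).isBounded
  have hsub : cell n ⊆ WithLp.toLp 2 ''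
      Set.Icc (fun _ : Fin n => -(1 / 2 : ℝ)) (fun _ => 1 / 2) := fun t ht =>
    ⟨WithLp.ofLp t, ⟨fun i => (ht i).1, fun i => (ht i).2.le⟩, rfl⟩
  exact (hb.subset hsub).measure_lt_top

theorem ae_cell_forall_add {n : ℕ} {p : Rn n → Prop} (h : ∀ᵐ x, p x) :
    ∀ᵐ t ∂cellMeasure n, ∀ k : Zn n, p (t + latticePt k) := by
  rw [ae_all_iff]
  intro k
  exact ae_restrict_of_ae
    ((measurePreserving_add_right volume (latticePt k)).quasiMeasurePreserving.ae h)

theorem aemeasurable_cell_add {n : ℕ} {β : Type*} [MeasurableSpace β] {F : Rn n → β}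
    (hF : AEMeasurable F) (k : Zn n) :
    AEMeasurable (fun t => F (t + latticePt k)) (cellMeasure n) :=
  (hF.comp_quasiMeasurePreserving
    (measurePreserving_add_right volume (latticePt k)).quasiMeasurePreserving).restrict

/-- The level sets of `cellIndex` partition ℝⁿ, and each is a translate of the half-open cell. -/
theorem lintegral_eq_lintegral_cell_tsum {n : ℕ} {F : Rn n → ℝ≥0∞} (hF : AEMeasurable F) :
    ∫⁻ x, F x = ∫⁻ t, ∑' k : Zn n, F (t + latticePt k) ∂cellMeasure n := by
  rw [lintegral_tsum fun k => aemeasurable_cell_add hF k]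
  have hU : (⋃ k : Zn n, cellIndex ⁻¹' {k}) = (Set.univ : Set (Rn n)) := by
    ext x; simp
  rw [← setLIntegral_univ, ← hU, lintegral_iUnion
    (fun k => measurable_cellIndex (measurableSet_singleton k))
    (fun i j hij => Disjoint.preimage _ (by simpa using hij))]
  refine tsum_congr fun k => ?_
  have hpre : (fun t : Rn n => t + latticePt k) ⁻¹' (cellIndex ⁻¹' {k}) = cell n := by
    ext t; simpa using cellIndex_eq_iff t k
  rw [← (measurePreserving_add_right volume (latticePt k)).setLIntegral_comp_preimage_emb
    (measurableEmbedding_addRight _), hpre]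

/-! ### The canonical Hilbert basis of the weighted sequence space -/

/-- The Hilbert basis of `ℓ²_s(ℤⁿ)` given by the normalised unit sequences. -/
def seqBasis (n : ℕ) (s : ℝ) : HilbertBasis (Zn n) ℂ (SeqSpace n s) :=
  HilbertBasis.ofRepr { SeqSpace.toL2 n s with norm_map' := fun _ => rfl }

theorem toL2_apply_eq_inner {n : ℕ} {s : ℝ} (c : SeqSpace n s) (k : Zn n) :
    SeqSpace.toL2 n s c k = inner ℂ (seqBasis n s k) c :=
  (seqBasis n s).repr_apply_apply c k

instance separableSpace_seqSpace (n : ℕ) (s : ℝ) :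
    TopologicalSpace.SeparableSpace (SeqSpace n s) := by
  have h := ((Set.countable_range (seqBasis n s)).isSeparable.span (R := ℂ)).closure
  rw [← Submodule.topologicalClosure_coe, (seqBasis n s).dense_span] at h
  exact TopologicalSpace.isSeparable_univ_iff.mp h

/-- The finite partial sums of the basis expansion are measurable and converge pointwise to `G`. -/
theorem _root_.HilbertBasis.aestronglyMeasurable_of_inner {ι 𝕜 E α : Type*} [RCLike 𝕜]
    [NormedAddCommGroup E] [InnerProductSpace 𝕜 E] [Countable ι] (b : HilbertBasis ι 𝕜 E)
    [MeasurableSpace α] {μ : Measure α} {G : α → E}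
    (hG : ∀ i, AEStronglyMeasurable (fun t => inner 𝕜 (b i) (G t)) μ) :
    AEStronglyMeasurable G μ := by
  refine aestronglyMeasurable_of_tendsto_ae Filter.atTop
    (f := fun (S : Finset ι) t => ∑ i ∈ S, inner 𝕜 (b i) (G t) • b i) (fun S => ?_)
    (Filter.Eventually.of_forall fun t => ?_)
  · exact Finset.aestronglyMeasurable_fun_sum S fun i _ => (hG i).smul_const (b i)
  · have h := b.hasSum_repr (G t)
    simp only [b.repr_apply_apply] at h
    exact h

theorem enorm_lp_two_sq {ι : Type*} (c : lp (fun _ : ι => ℂ) 2) :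
    ‖c‖ₑ ^ 2 = ∑' k, ‖c k‖ₑ ^ 2 := by
  have h := lp.hasSum_norm (p := 2) (by norm_num) c
  simp only [ENNReal.toReal_ofNat, Real.rpow_ofNat] at h
  have h2 := h.tsum_eq
  rw [← ofReal_norm, ← ENNReal.ofReal_pow (norm_nonneg _), ← h2,
    ENNReal.ofReal_tsum_of_nonneg (fun k => by positivity) h.summable]
  refine tsum_congr fun k => ?_
  rw [ENNReal.ofReal_pow (norm_nonneg _), ofReal_norm]

theorem memℓp_two_of_tsum_enorm_ne_top {ι : Type*} {c : ι → ℂ}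
    (h : ∑' k, ‖c k‖ₑ ^ 2 ≠ ∞) : Memℓp c 2 := by
  refine memℓp_gen ?_
  have h' := ENNReal.summable_toReal h
  simpa using h'

theorem enorm_seqSpace_sq {n : ℕ} {s : ℝ} (c : SeqSpace n s) :
    ‖c‖ₑ ^ 2 = ∑' k, ‖SeqSpace.toL2 n s c k‖ₑ ^ 2 :=
  enorm_lp_two_sq (SeqSpace.toL2 n s c)

/-! ### The fiberization as an isometry onto `L²(𝕋ⁿ; ℓ²_s)` -/

theorem eLpNorm_two_sq {α E : Type*} [MeasurableSpace α] [NormedAddCommGroup E] (μ : Measure α)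
    (F : α → E) : eLpNorm F 2 μ ^ 2 = ∫⁻ x, ‖F x‖ₑ ^ 2 ∂μ := by
  have h := eLpNorm_nnreal_pow_eq_lintegral (f := F) (μ := μ) (p := 2) (by norm_num)
  simpa using h

theorem lintegral_enorm_weightedFourier {n : ℕ} {s : ℝ} (f : Sobolev n s) :
    ∫⁻ x, ‖Sobolev.weightedFourier n s f x‖ₑ ^ 2 = ‖f‖ₑ ^ 2 := by
  rw [← eLpNorm_two_sq]
  have h : ‖f‖ₑ = ‖Sobolev.weightedFourier n s f‖ₑ := rfl
  rw [h, Lp.enorm_def]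

theorem lintegral_cell_tsum_weightedFourier {n : ℕ} {s : ℝ} (f : Sobolev n s) :
    ∫⁻ t, ∑' k : Zn n, ‖Sobolev.weightedFourier n s f (t + latticePt k)‖ₑ ^ 2 ∂cellMeasure n =
      ‖f‖ₑ ^ 2 := by
  rw [← lintegral_enorm_weightedFourier, lintegral_eq_lintegral_cell_tsum]
  exact ((Lp.aestronglyMeasurable _).enorm).pow_const 2

/-- The periodized square sum has finite integral over the cell, hence is finite a.e. There the
definition of `fiber` takes its nonzero branch, and the weights cancel. -/
theorem toL2_fiber_ae {n : ℕ} {s : ℝ} (f : Sobolev n s) :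
    ∀ᵐ t ∂cellMeasure n, ∀ k, SeqSpace.toL2 n s (fiber f t) k =
      Sobolev.weightedFourier n s f (t + latticePt k) := by
  have hm : AEMeasurable (fun t => ∑' k : Zn n,
      ‖Sobolev.weightedFourier n s f (t + latticePt k)‖ₑ ^ 2) (cellMeasure n) :=
    AEMeasurable.tsum fun k => aemeasurable_cell_add
      (((Lp.aestronglyMeasurable (Sobolev.weightedFourier n s f)).enorm).pow_const 2) k
  have hfin := ae_lt_top' hm (by
    rw [lintegral_cell_tsum_weightedFourier]
    exact ENNReal.pow_ne_top enorm_ne_top)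
  filter_upwards [hfin] with t ht k
  have hcancel : ∀ k : Zn n, (weight s (latticePt k) : ℂ) *
      (Sobolev.weightedFourier n s f (t + latticePt k) / (weight s (latticePt k) : ℂ)) =
      Sobolev.weightedFourier n s f (t + latticePt k) := fun k =>
    mul_div_cancel₀ _ (weight_ne_zero s _)
  have hmem : (fun k : Zn n => Sobolev.weightedFourier n s f (t + latticePt k) /
      (weight s (latticePt k) : ℂ)) ∈ seqSubmodule n s := by
    change Memℓp (fun k : Zn n => (weight s (latticePt k) : ℂ) *
      (Sobolev.weightedFourier n s f (t + latticePt k) / (weight s (latticePt k) : ℂ))) 2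
    simp only [hcancel]
    exact memℓp_two_of_tsum_enorm_ne_top ht.ne
  have hfib : fiber f t = ⟨_, hmem⟩ := dif_pos hmem
  rw [hfib]
  exact hcancel k

theorem seqSpace_ext {n : ℕ} {s : ℝ} {c d : SeqSpace n s}
    (h : ∀ k, SeqSpace.toL2 n s c k = SeqSpace.toL2 n s d k) : c = d :=
  (SeqSpace.toL2 n s).injective (lp.ext (funext h))

theorem fiber_add_ae {n : ℕ} {s : ℝ} (f g : Sobolev n s) :
    fiber (f + g) =ᵐ[cellMeasure n] fiber f + fiber g := by
  filter_upwards [toL2_fiber_ae f, toL2_fiber_ae g, toL2_fiber_ae (f + g),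
    ae_cell_forall_add (Lp.coeFn_add (Sobolev.weightedFourier n s f)
      (Sobolev.weightedFourier n s g))] with t hf hg hfg hadd
  refine seqSpace_ext fun k => ?_
  rw [hfg, map_add, hadd, Pi.add_apply, Pi.add_apply, map_add, lp.coeFn_add, Pi.add_apply, hf, hg]

theorem fiber_smul_ae {n : ℕ} {s : ℝ} (r : ℂ) (f : Sobolev n s) :
    fiber (r • f) =ᵐ[cellMeasure n] r • fiber f := by
  filter_upwards [toL2_fiber_ae f, toL2_fiber_ae (r • f),
    ae_cell_forall_add (Lp.coeFn_smul r (Sobolev.weightedFourier n s f))] with t hf hrf hsmul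
  refine seqSpace_ext fun k => ?_
  rw [hrf, map_smul, hsmul, Pi.smul_apply, Pi.smul_apply, map_smul, lp.coeFn_smul, Pi.smul_apply,
    hf]

theorem fiber_sub_ae {n : ℕ} {s : ℝ} (f g : Sobolev n s) :
    fiber (f - g) =ᵐ[cellMeasure n] fiber f - fiber g := by
  have h := fiber_add_ae (f - g) g
  rw [sub_add_cancel] at h
  filter_upwards [h] with t ht
  rw [Pi.sub_apply, ht, Pi.add_apply, add_sub_cancel_right]

theorem aestronglyMeasurable_fiber {n : ℕ} {s : ℝ} (f : Sobolev n s) :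
    AEStronglyMeasurable (fiber f) (cellMeasure n) := by
  refine (seqBasis n s).aestronglyMeasurable_of_inner fun k => ?_
  refine (aemeasurable_cell_add (Lp.aestronglyMeasurable
    (Sobolev.weightedFourier n s f)).aemeasurable k).aestronglyMeasurable.congr ?_
  filter_upwards [toL2_fiber_ae f] with t ht
  rw [← toL2_apply_eq_inner, ht]

theorem lintegral_enorm_fiber {n : ℕ} {s : ℝ} (f : Sobolev n s) :
    ∫⁻ t, ‖fiber f t‖ₑ ^ 2 ∂cellMeasure n = ‖f‖ₑ ^ 2 := by
  rw [← lintegral_cell_tsum_weightedFourier]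
  refine lintegral_congr_ae ?_
  filter_upwards [toL2_fiber_ae f] with t ht
  simp only [enorm_seqSpace_sq, ht]

theorem eLpNorm_fiber {n : ℕ} {s : ℝ} (f : Sobolev n s) :
    eLpNorm (fiber f) 2 (cellMeasure n) = ‖f‖ₑ := by
  have h := (eLpNorm_two_sq (cellMeasure n) (fiber f)).trans (lintegral_enorm_fiber f)
  exact (ENNReal.pow_right_strictMono two_ne_zero).injective h

theorem memLp_fiber {n : ℕ} {s : ℝ} (f : Sobolev n s) :
    MemLp (fiber f) 2 (cellMeasure n) :=
  ⟨aestronglyMeasurable_fiber f, by rw [eLpNorm_fiber]; exact enorm_lt_top⟩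

/-- The fiberization as a linear isometry into `L²(𝕋ⁿ; ℓ²_s)`. -/
def fiberL2 (n : ℕ) (s : ℝ) : Sobolev n s →ₗᵢ[ℂ] Lp (SeqSpace n s) 2 (cellMeasure n) where
  toFun f := (memLp_fiber f).toLp
  map_add' f g := by
    rw [← MemLp.toLp_add]
    exact MemLp.toLp_congr _ _ (fiber_add_ae f g)
  map_smul' r f := by
    rw [RingHom.id_apply, ← MemLp.toLp_const_smul]
    exact MemLp.toLp_congr _ _ (fiber_smul_ae r f)
  norm_map' f := by
    change ‖(memLp_fiber f).toLp‖ = ‖f‖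
    rw [Lp.norm_toLp, eLpNorm_fiber, toReal_enorm]

theorem coeFn_fiberL2 {n : ℕ} {s : ℝ} (f : Sobolev n s) :
    fiberL2 n s f =ᵐ[cellMeasure n] fiber f :=
  (memLp_fiber f).coeFn_toLp

theorem integrable_inner_fiber {n : ℕ} {s : ℝ} (f g : Sobolev n s) :
    Integrable (fun t => inner ℂ (fiber f t) (fiber g t)) (cellMeasure n) := by
  refine (L2.integrable_inner (𝕜 := ℂ) (fiberL2 n s f) (fiberL2 n s g)).congr ?_
  filter_upwards [coeFn_fiberL2 f, coeFn_fiberL2 g] with t hf hg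
  rw [hf, hg]

theorem inner_eq_integral_fiber {n : ℕ} {s : ℝ} (f g : Sobolev n s) :
    inner ℂ f g = ∫ t, inner ℂ (fiber f t) (fiber g t) ∂cellMeasure n := by
  rw [← (fiberL2 n s).inner_map_map, L2.inner_def]
  refine integral_congr_ae ?_
  filter_upwards [coeFn_fiberL2 f, coeFn_fiberL2 g] with t hf hg
  rw [hf, hg]

theorem eq_of_fiber_ae_eq {n : ℕ} {s : ℝ} {f g : Sobolev n s}
    (h : fiber f =ᵐ[cellMeasure n] fiber g) : f = g :=
  (fiberL2 n s).injective (MemLp.toLp_congr (memLp_fiber f) (memLp_fiber g) h)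

theorem measurable_cellwise {n : ℕ} {β : Type*} [MeasurableSpace β] {w : Zn n → Rn n → β}
    (hw : ∀ k, Measurable (w k)) :
    Measurable fun x => w (cellIndex x) (x - latticePt (cellIndex x)) := by
  have h : Measurable fun p : Rn n × Zn n => w p.2 p.1 :=
    measurable_from_prod_countable_left hw
  have hφ : Measurable fun x : Rn n => (x - latticePt (cellIndex x), cellIndex x) :=
    (measurable_id.sub (measurable_latticePt.comp measurable_cellIndex)).prodMk
      measurable_cellIndex
  exact h.comp hφ

/-- Surjectivity of the fiberization: the coordinates of `G` are spread over the translated cells to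
give a function on ℝⁿ, which serves as the weighted Fourier transform of the preimage. -/
theorem exists_fiber_ae_eq {n : ℕ} {s : ℝ} {G : Rn n → SeqSpace n s}
    (hG : MemLp G 2 (cellMeasure n)) : ∃ f : Sobolev n s, fiber f =ᵐ[cellMeasure n] G := by
  -- A genuinely measurable representative makes the unfolded function `u` measurable everywhere.
  obtain ⟨G', hG'm, hGG'⟩ := hG.1
  set u : Rn n → ℂ := fun x =>
    SeqSpace.toL2 n s (G' (x - latticePt (cellIndex x))) (cellIndex x) with hu_def
  have hu : ∀ t ∈ cell n, ∀ k, u (t + latticePt k) = SeqSpace.toL2 n s (G' t) k := by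
    intro t ht k
    simp only [hu_def, (cellIndex_eq_iff t k).mpr ht, add_sub_cancel_right]
  have hum : Measurable u := by
    refine measurable_cellwise (w := fun k t => SeqSpace.toL2 n s (G' t) k) fun k => ?_
    simp only [toL2_apply_eq_inner]
    exact (stronglyMeasurable_const.inner hG'm).measurable
  have hcell : ∀ᵐ t ∂cellMeasure n, t ∈ cell n := ae_restrict_mem (measurableSet_cell n)
  have hint : ∫⁻ x, ‖u x‖ₑ ^ 2 = ∫⁻ t, ‖G t‖ₑ ^ 2 ∂cellMeasure n := by
    rw [lintegral_eq_lintegral_cell_tsum (hum.enorm.pow_const 2).aemeasurable]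
    refine lintegral_congr_ae ?_
    filter_upwards [hcell, hGG'] with t ht htG
    simp only [htG, enorm_seqSpace_sq, hu t ht]
  have huL : MemLp u 2 volume := by
    refine ⟨hum.aestronglyMeasurable, ?_⟩
    have h := (eLpNorm_two_sq volume u).trans (hint.trans (eLpNorm_two_sq _ G).symm)
    rw [(ENNReal.pow_right_strictMono two_ne_zero).injective h]
    exact hG.2
  refine ⟨(Sobolev.weightedFourier n s).symm huL.toLp, ?_⟩
  filter_upwards [toL2_fiber_ae ((Sobolev.weightedFourier n s).symm huL.toLp),
    ae_cell_forall_add huL.coeFn_toLp, hcell, hGG'] with t h1 h2 ht htG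
  refine seqSpace_ext fun k => ?_
  rw [h1, LinearEquiv.apply_symm_apply, h2, hu t ht, htG]

/-! ### Translations are isometric -/

/-- Both operators are Fourier multipliers; on test functions, after an inverse Fourier transform,
they are two commuting pointwise multiplications. -/
theorem besselPotential_translateDist {n : ℕ} (s : ℝ) (a : Rn n) (f : 𝓢'(Rn n, ℂ)) :
    besselPotential (Rn n) ℂ s (translateDist a f) =
      translateDist a (besselPotential (Rn n) ℂ s f) := by
  ext φ
  refine congrArg f (?_ : SchwartzMap.compSubConstCLM ℂ (-a) (𝓕 (SchwartzMap.smulLeftCLM ℂ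
      (fun x : Rn n => (((1 + ‖x‖ ^ 2) ^ (s / 2) : ℝ) : ℂ)) (𝓕⁻ φ))) =
    𝓕 (SchwartzMap.smulLeftCLM ℂ (fun x : Rn n => (((1 + ‖x‖ ^ 2) ^ (s / 2) : ℝ) : ℂ))
      (𝓕⁻ (SchwartzMap.compSubConstCLM ℂ (-a) φ))))
  have h : Function.Injective fun ψ : 𝓢(Rn n, ℂ) => (𝓕⁻ ψ : 𝓢(Rn n, ℂ)) :=
    Function.LeftInverse.injective (g := fun ψ => 𝓕 ψ) fun ψ => fourier_fourierInv_eq ψ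
  apply h
  ext x
  simp only
  rw [fourierInv_compSubConst, fourierInv_fourier_eq, fourierInv_fourier_eq,
    SchwartzMap.smulLeftCLM_apply_apply (by fun_prop),
    SchwartzMap.smulLeftCLM_apply_apply (by fun_prop), fourierInv_compSubConst]
  simp only [smul_eq_mul]
  ring

theorem translateDist_coe_Lp {n : ℕ} (a : Rn n) (g : Lp ℂ 2 (volume : Measure (Rn n))) :
    translateDist a (g : 𝓢'(Rn n, ℂ)) = (Lp.compMeasurePreserving (fun x : Rn n => x - a)
      (measurePreserving_sub_right volume a) g : 𝓢'(Rn n, ℂ)) := by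
  ext φ
  change (g : 𝓢'(Rn n, ℂ)) (SchwartzMap.compSubConstCLM ℂ (-a) φ) = _
  rw [Lp.toTemperedDistribution_apply, Lp.toTemperedDistribution_apply,
    ← integral_sub_right_eq_self _ a]
  apply integral_congr_ae
  filter_upwards [Lp.coeFn_compMeasurePreserving g (measurePreserving_sub_right volume a)]
    with x hx
  rw [hx]
  simp

/-- Write f as a Bessel potential of some g in L². Translating f translates g, and Plancherel turns
the Sobolev norm into the translation-invariant L² norm of g. -/
theorem norm_shift {n : ℕ} {s : ℝ} (k : Zn n) (f : Sobolev n s) : ‖shift k f‖ = ‖f‖ := by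
  set g : Lp ℂ 2 (volume : Measure (Rn n)) := 𝓕⁻ (Sobolev.weightedFourier n s f) with hg
  set g' := Lp.compMeasurePreserving (fun x : Rn n => x - latticePt k)
    (measurePreserving_sub_right volume (latticePt k)) g with hg'
  have hf : Sobolev.weightedFourier n s f = 𝓕 g := by rw [hg, fourier_fourierInv_eq]
  have hdist : f.dist = besselPotential (Rn n) ℂ (-s) (g : 𝓢'(Rn n, ℂ)) := by
    conv_lhs => rw [← (Sobolev.weightedFourier n s).symm_apply_apply f]
    rfl
  have hshift : Sobolev.weightedFourier n s (shift k f) = 𝓕 g' := by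
    rw [← LinearEquiv.eq_symm_apply]
    apply Subtype.ext
    change translateDist (latticePt k) f.dist =
      besselPotential (Rn n) ℂ (-s) ((𝓕⁻ (𝓕 g') : Lp ℂ 2 (volume : Measure (Rn n))) : 𝓢'(Rn n, ℂ))
    rw [fourierInv_fourier_eq, hdist, ← besselPotential_translateDist, translateDist_coe_Lp]
  change ‖Sobolev.weightedFourier n s (shift k f)‖ = ‖Sobolev.weightedFourier n s f‖
  rw [hf, hshift, Lp.norm_fourier_eq, Lp.norm_fourier_eq, hg', Lp.norm_compMeasurePreserving]

theorem shift_shift_neg {n : ℕ} {s : ℝ} (k : Zn n) (f : Sobolev n s) :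
    shift k (shift (-k) f) = f := by
  apply Subtype.ext
  ext φ
  change f.dist (SchwartzMap.compSubConstCLM ℂ (-latticePt (-k))
    (SchwartzMap.compSubConstCLM ℂ (-latticePt k) φ)) = f.dist φ
  congr 1
  ext x
  have h : latticePt (-k) = -latticePt k := by ext i; simp
  simp [h]

theorem inner_shift {n : ℕ} {s : ℝ} (k : Zn n) (f g : Sobolev n s) :
    inner ℂ (shift k f) g = inner ℂ f (shift (-k) g) := by
  let T : Sobolev n s →ₗᵢ[ℂ] Sobolev n s := ⟨shift k, norm_shift k⟩
  conv_lhs => rw [← shift_shift_neg k g]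
  exact T.inner_map_map f (shift (-k) g)

/-- Take adjoints in the commutation of L with T_{-k}; invariance of V under both T_k and T_{-k}
keeps the computation inside V. -/
theorem isShiftPreserving_adjoint {n : ℕ} {s : ℝ} {V : ClosedSubmodule ℂ (Sobolev n s)}
    (hV : IsShiftInvariant V) {L : V.toSubmodule →L[ℂ] V.toSubmodule}
    (hL : IsShiftPreserving (V.toSubmodule.subtypeL ∘L L)) :
    IsShiftPreserving (V.toSubmodule.subtypeL ∘L ContinuousLinearMap.adjoint L) := by
  intro k f h
  have key : ContinuousLinearMap.adjoint L ⟨shift k (f : Sobolev n s), h⟩ =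
      (⟨shift k (ContinuousLinearMap.adjoint L f : Sobolev n s), hV k _ (Subtype.coe_prop _)⟩ :
        V.toSubmodule) := by
    refine ext_inner_right ℂ fun g => ?_
    have hg : shift (-k) (g : Sobolev n s) ∈ V.toSubmodule := hV (-k) _ g.2
    calc inner ℂ (ContinuousLinearMap.adjoint L ⟨shift k (f : Sobolev n s), h⟩) g
        = inner ℂ (shift k (f : Sobolev n s)) (L g : Sobolev n s) := by
          rw [ContinuousLinearMap.adjoint_inner_left, Submodule.coe_inner]
      _ = inner ℂ (f : Sobolev n s) (L ⟨shift (-k) (g : Sobolev n s), hg⟩ : Sobolev n s) := by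
          rw [inner_shift]
          exact congrArg (inner ℂ (f : Sobolev n s)) (hL (-k) g hg).symm
      _ = inner ℂ (ContinuousLinearMap.adjoint L f : Sobolev n s)
            (shift (-k) (g : Sobolev n s)) := by
          rw [← Submodule.coe_inner, ← ContinuousLinearMap.adjoint_inner_left, Submodule.coe_inner]
      _ = _ := by rw [← inner_shift, Submodule.coe_inner]
  exact congrArg Subtype.val key

section Fiberwise

variable {n : ℕ} {s : ℝ} {V : ClosedSubmodule ℂ (Sobolev n s)} {J : RangeFunction n s}

/-! ### Sections of a range function -/

theorem IsRangeFunctionOf.ae_mem (hJ : IsRangeFunctionOf V J) (f : V.toSubmodule) :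
    ∀ᵐ t ∂cellMeasure n, fiber (f : Sobolev n s) t ∈ (J t).toSubmodule :=
  (hJ.2 f).mp f.2

theorem IsRangeFunctionOf.exists_fiber_ae_eq (hJ : IsRangeFunctionOf V J)
    {G : Rn n → SeqSpace n s} (hG : MemLp G 2 (cellMeasure n))
    (hGJ : ∀ᵐ t ∂cellMeasure n, G t ∈ (J t).toSubmodule) :
    ∃ f : V.toSubmodule, fiber (f : Sobolev n s) =ᵐ[cellMeasure n] G := by
  obtain ⟨f, hf⟩ := SISobolev.exists_fiber_ae_eq hG
  refine ⟨⟨f, (hJ.2 f).mpr ?_⟩, hf⟩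
  filter_upwards [hf, hGJ] with t h₁ h₂
  rw [h₁]; exact h₂

/-- The cell has finite measure and projections are contractions, so only measurability needs an
argument, and the basis coordinates suffice for it. -/
theorem RangeFunction.IsMeasurable.memLp_starProjection (hJ : J.IsMeasurable)
    (a : SeqSpace n s) :
    MemLp (fun t => (J t).toSubmodule.starProjection a) 2 (cellMeasure n) := by
  refine MemLp.of_bound ?_ ‖a‖ (Filter.Eventually.of_forall fun t =>
    Submodule.norm_starProjection_apply_le _ a)
  refine (seqBasis n s).aestronglyMeasurable_of_inner fun k => ?_
  have h := (Complex.continuous_conj.measurable.comp_aemeasurable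
    (hJ a (seqBasis n s k))).aestronglyMeasurable
  refine h.congr (Filter.Eventually.of_forall fun t => ?_)
  exact inner_conj_symm _ _

/-- Project a dense sequence of ℓ²_s onto J(t): a continuous surjection preserves density. -/
theorem IsRangeFunctionOf.exists_dense_sections (hJ : IsRangeFunctionOf V J) :
    ∃ f : ℕ → V.toSubmodule, ∀ᵐ t ∂cellMeasure n,
      ∃ h : ∀ i, fiber (f i : Sobolev n s) t ∈ (J t).toSubmodule,
        DenseRange fun i => (⟨fiber (f i : Sobolev n s) t, h i⟩ : (J t).toSubmodule) := by
  let a : ℕ → SeqSpace n s := TopologicalSpace.denseSeq (SeqSpace n s)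
  have hex : ∀ i, ∃ f : V.toSubmodule, fiber (f : Sobolev n s) =ᵐ[cellMeasure n]
      fun t => (J t).toSubmodule.starProjection (a i) := fun i =>
    hJ.exists_fiber_ae_eq (hJ.1.memLp_starProjection (a i))
      (Filter.Eventually.of_forall fun t => Submodule.starProjection_apply_mem _ _)
  choose f hf using hex
  refine ⟨f, ?_⟩
  filter_upwards [ae_all_iff.mpr hf] with t ht
  refine ⟨fun i => by rw [ht i]; exact Submodule.starProjection_apply_mem _ _, ?_⟩
  have hsurj : Function.Surjective (J t).toSubmodule.orthogonalProjectionOnto := fun v =>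
    ⟨v, Submodule.orthogonalProjectionOnto_mem_subspace_eq_self v⟩
  have hd := hsurj.denseRange.comp (TopologicalSpace.denseRange_denseSeq (SeqSpace n s))
    (J t).toSubmodule.orthogonalProjectionOnto.continuous
  convert hd using 2 with i
  exact Subtype.ext (ht i)

theorem IsRangeFunctionOf.exists_indicator (hJ : IsRangeFunctionOf V J) (f : V.toSubmodule)
    {E : Set (Rn n)} (hE : MeasurableSet E) :
    ∃ g : V.toSubmodule,
      fiber (g : Sobolev n s) =ᵐ[cellMeasure n] E.indicator (fiber (f : Sobolev n s)) := by
  refine hJ.exists_fiber_ae_eq ((memLp_fiber _).indicator hE) ?_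
  filter_upwards [hJ.ae_mem f] with t ht
  by_cases h : t ∈ E
  · rwa [Set.indicator_of_mem h]
  · rw [Set.indicator_of_notMem h]; exact Submodule.zero_mem _

theorem eq_of_subtype_fiber_ae_eq {f g : V.toSubmodule}
    (h : fiber (f : Sobolev n s) =ᵐ[cellMeasure n] fiber (g : Sobolev n s)) : f = g :=
  Subtype.ext (eq_of_fiber_ae_eq h)

/-! ### Decomposable operators -/

/-- `L` acts fiberwise as the family of operators `S(t)` on `J(t)`. -/
def ActsFiberwise (L : V.toSubmodule →L[ℂ] V.toSubmodule)
    (S : (t : Rn n) → (J t).toSubmodule →L[ℂ] (J t).toSubmodule) : Prop :=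
  ∀ f : V.toSubmodule, ∀ᵐ t ∂cellMeasure n,
    ∃ h : fiber (f : Sobolev n s) t ∈ (J t).toSubmodule,
      fiber (L f : Sobolev n s) t = S t ⟨fiber (f : Sobolev n s) t, h⟩

variable {L L' : V.toSubmodule →L[ℂ] V.toSubmodule}
  {S S' : (t : Rn n) → (J t).toSubmodule →L[ℂ] (J t).toSubmodule}

namespace ActsFiberwise

theorem one (hJ : IsRangeFunctionOf V J) :
    ActsFiberwise (J := J) (1 : V.toSubmodule →L[ℂ] V.toSubmodule) fun _ => 1 := fun f => by
  filter_upwards [hJ.ae_mem f] with t ht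
  exact ⟨ht, rfl⟩

theorem comp (hL : ActsFiberwise L S) (hL' : ActsFiberwise L' S') :
    ActsFiberwise (L * L') fun t => S t * S' t := fun f => by
  filter_upwards [hL' f, hL (L' f)] with t ⟨h, ht⟩ ⟨h', ht'⟩
  refine ⟨h, ht'.trans ?_⟩
  have : (⟨fiber (L' f : Sobolev n s) t, h'⟩ : (J t).toSubmodule) =
      S' t ⟨fiber (f : Sobolev n s) t, h⟩ := Subtype.ext ht
  rw [this]
  rfl

theorem sub (hL : ActsFiberwise L S) (hL' : ActsFiberwise L' S') :
    ActsFiberwise (L - L') fun t => S t - S' t := fun f => by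
  filter_upwards [hL f, hL' f, fiber_sub_ae (L f : Sobolev n s) (L' f : Sobolev n s)]
    with t ⟨h, ht⟩ ⟨h', ht'⟩ hs
  refine ⟨h, ?_⟩
  rw [Pi.sub_apply, ht, ht'] at hs
  exact hs

theorem smul (c : ℂ) (hL : ActsFiberwise L S) :
    ActsFiberwise (c • L) fun t => c • S t := fun f => by
  filter_upwards [hL f, fiber_smul_ae c (L f : Sobolev n s)] with t ⟨h, ht⟩ hs
  refine ⟨h, ?_⟩
  change fiber (c • (L f : Sobolev n s)) t = _
  rw [hs, Pi.smul_apply, ht]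
  rfl

/-- Off a countable union of null sets the two continuous fiber operators agree on the dense
sections; conversely, an element of V is determined by its fibers. -/
theorem eq_iff (hJ : IsRangeFunctionOf V J) (hL : ActsFiberwise L S)
    (hL' : ActsFiberwise L' S') : L = L' ↔ ∀ᵐ t ∂cellMeasure n, S t = S' t := by
  constructor
  · rintro rfl
    obtain ⟨f, hf⟩ := hJ.exists_dense_sections
    filter_upwards [hf, ae_all_iff.mpr fun i => hL (f i), ae_all_iff.mpr fun i => hL' (f i)]
      with t ⟨hm, hd⟩ h h'
    refine ContinuousLinearMap.ext fun v => ?_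
    refine congrFun (hd.equalizer (S t).continuous (S' t).continuous (funext fun i => ?_)) v
    obtain ⟨_, h₁⟩ := h i
    obtain ⟨_, h₂⟩ := h' i
    exact Subtype.ext (h₁.symm.trans h₂)
  · intro h
    refine ContinuousLinearMap.ext fun f => eq_of_subtype_fiber_ae_eq ?_
    filter_upwards [h, hL f, hL' f] with t h ⟨_, h₁⟩ ⟨_, h₂⟩
    rw [h₁, h₂, h]

theorem ae_eq_indicator (hL : ActsFiberwise L S) {f g : V.toSubmodule} {E : Set (Rn n)}
    (hg : fiber (g : Sobolev n s) =ᵐ[cellMeasure n] E.indicator (fiber (f : Sobolev n s))) :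
    fiber (L g : Sobolev n s) =ᵐ[cellMeasure n] E.indicator (fiber (L f : Sobolev n s)) := by
  filter_upwards [hL f, hL g, hg] with t ⟨hf, h₁⟩ ⟨hg, h₂⟩ h
  by_cases ht : t ∈ E
  · rw [Set.indicator_of_mem ht] at h ⊢
    rw [h₁, h₂]
    congr 2
    exact Subtype.ext h
  · rw [Set.indicator_of_notMem ht] at h ⊢
    have : (⟨fiber (g : Sobolev n s) t, hg⟩ : (J t).toSubmodule) = 0 := Subtype.ext h
    rw [h₂, this, map_zero]; rfl

/-- Testing the adjoint relation against the cutoff of `g` to E shows that both sides have equal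
integrals over every measurable E. -/
theorem inner_adjoint_ae_eq (hJ : IsRangeFunctionOf V J) (hL : ActsFiberwise L S)
    (f g : V.toSubmodule) :
    (fun t => inner ℂ (fiber (ContinuousLinearMap.adjoint L f : Sobolev n s) t)
      (fiber (g : Sobolev n s) t)) =ᵐ[cellMeasure n]
    fun t => inner ℂ (fiber (f : Sobolev n s) t) (fiber (L g : Sobolev n s) t) := by
  refine Integrable.ae_eq_of_forall_setIntegral_eq _ _ (integrable_inner_fiber _ _)
    (integrable_inner_fiber _ _) fun E hE _ => ?_
  obtain ⟨gE, hgE⟩ := hJ.exists_indicator g hE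
  have hLgE := hL.ae_eq_indicator hgE
  have hset : ∀ (u v w : Sobolev n s), fiber w =ᵐ[cellMeasure n] E.indicator (fiber v) →
      ∫ t in E, inner ℂ (fiber u t) (fiber v t) ∂cellMeasure n = inner ℂ u w := by
    intro u v w hw
    rw [inner_eq_integral_fiber, ← integral_indicator hE]
    refine integral_congr_ae ?_
    filter_upwards [hw] with t ht
    by_cases h : t ∈ E <;> simp [ht, h]
  rw [hset _ _ _ hgE, hset _ _ _ hLgE, ← Submodule.coe_inner, ← Submodule.coe_inner,
    ContinuousLinearMap.adjoint_inner_left]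

theorem adjoint (hJ : IsRangeFunctionOf V J) (hL : ActsFiberwise L S) :
    ActsFiberwise (ContinuousLinearMap.adjoint L)
      fun t => ContinuousLinearMap.adjoint (S t) := fun f => by
  obtain ⟨g, hg⟩ := hJ.exists_dense_sections
  filter_upwards [hJ.ae_mem f, hJ.ae_mem (ContinuousLinearMap.adjoint L f), hg,
    ae_all_iff.mpr fun i => hL (g i), ae_all_iff.mpr fun i => inner_adjoint_ae_eq hJ hL f (g i)]
    with t hf hLf ⟨hm, hd⟩ hLg hin
  refine ⟨hf, ?_⟩
  have key : (⟨fiber (ContinuousLinearMap.adjoint L f : Sobolev n s) t, hLf⟩ :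
      (J t).toSubmodule) = ContinuousLinearMap.adjoint (S t) ⟨fiber (f : Sobolev n s) t, hf⟩ := by
    refine ext_inner_right ℂ fun v => ?_
    refine congrFun (hd.equalizer (continuous_const.inner continuous_id)
      (continuous_const.inner continuous_id) (funext fun i => ?_)) v
    obtain ⟨_, h⟩ := hLg i
    simp only [Function.comp_apply, id_eq, ContinuousLinearMap.adjoint_inner_left,
      Submodule.coe_inner]
    rw [hin i, h]
  exact congrArg Subtype.val key

theorem isSelfAdjoint_iff (hJ : IsRangeFunctionOf V J) (hL : ActsFiberwise L S) :
    IsSelfAdjoint L ↔ ∀ᵐ t ∂cellMeasure n, IsSelfAdjoint (S t) :=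
  (hL.adjoint hJ).eq_iff hJ hL

theorem mem_unitary_iff (hJ : IsRangeFunctionOf V J) (hL : ActsFiberwise L S) :
    L ∈ unitary (V.toSubmodule →L[ℂ] V.toSubmodule) ↔
      ∀ᵐ t ∂cellMeasure n, S t ∈ unitary ((J t).toSubmodule →L[ℂ] (J t).toSubmodule) := by
  simp only [Unitary.mem_iff, Filter.eventually_and]
  exact and_congr (((hL.adjoint hJ).comp hL).eq_iff hJ (one hJ))
    ((hL.comp (hL.adjoint hJ)).eq_iff hJ (one hJ))

/-- The quadratic form of L at a section cut off to E is the integral over E of the fiber forms.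
Nonnegativity for all E gives it a.e. on each dense section, then on J(t) by continuity. -/
theorem re_inner_nonneg_iff (hJ : IsRangeFunctionOf V J) (hL : ActsFiberwise L S) :
    (∀ f, 0 ≤ L.reApplyInnerSelf f) ↔
      ∀ᵐ t ∂cellMeasure n, ∀ v, 0 ≤ (S t).reApplyInnerSelf v := by
  constructor
  · intro h
    obtain ⟨f, hf⟩ := hJ.exists_dense_sections
    have hpos : ∀ i, ∀ᵐ t ∂cellMeasure n,
        0 ≤ (inner ℂ (fiber (L (f i) : Sobolev n s) t) (fiber (f i : Sobolev n s) t)).re := by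
      intro i
      refine ae_nonneg_of_forall_setIntegral_nonneg (integrable_inner_fiber _ _).re
        fun E hE _ => ?_
      obtain ⟨g, hg⟩ := hJ.exists_indicator (f i) hE
      have hLg := hL.ae_eq_indicator hg
      have hE' : ∫ t in E, (inner ℂ (fiber (L (f i) : Sobolev n s) t)
          (fiber (f i : Sobolev n s) t)).re ∂cellMeasure n = L.reApplyInnerSelf g := by
        rw [ContinuousLinearMap.reApplyInnerSelf_apply, Submodule.coe_inner,
          inner_eq_integral_fiber, ← integral_re (integrable_inner_fiber _ _),
          ← integral_indicator hE]
        refine integral_congr_ae ?_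
        filter_upwards [hg, hLg] with t h₁ h₂
        by_cases ht : t ∈ E <;> simp [h₁, h₂, ht]
      exact (h g).trans_eq hE'.symm
    filter_upwards [hf, ae_all_iff.mpr hpos, ae_all_iff.mpr fun i => hL (f i)]
      with t ⟨hm, hd⟩ hp hLf v
    refine isClosed_property hd (isClosed_le continuous_const
      (S t).reApplyInnerSelf_continuous) (fun i => ?_) v
    obtain ⟨_, h'⟩ := hLf i
    have hpi := hp i
    rw [h'] at hpi
    exact hpi
  · intro h f
    rw [ContinuousLinearMap.reApplyInnerSelf_apply, Submodule.coe_inner,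
      inner_eq_integral_fiber, ← integral_re (integrable_inner_fiber _ _)]
    refine integral_nonneg_of_ae ?_
    filter_upwards [h, hL f] with t ht ⟨hm, hf⟩
    rw [hf]
    exact ht ⟨_, hm⟩

theorem nonneg_iff (hJ : IsRangeFunctionOf V J) (hL : ActsFiberwise L S) :
    0 ≤ L ↔ ∀ᵐ t ∂cellMeasure n, 0 ≤ S t := by
  simp only [ContinuousLinearMap.nonneg_iff_isPositive, ContinuousLinearMap.isPositive_def',
    Filter.eventually_and]
  exact and_congr (hL.isSelfAdjoint_iff hJ) (hL.re_inner_nonneg_iff hJ)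

end ActsFiberwise

end Fiberwise

/-- Replaces the spectral condition by operator inequalities, which can be tested fiberwise. -/
theorem _root_.ContinuousLinearMap.isSelfAdjoint_and_spectrum_subset_iff {E : Type*}
    [NormedAddCommGroup E] [InnerProductSpace ℂ E] [CompleteSpace E] (T : E →L[ℂ] E) (A B : ℝ) :
    (IsSelfAdjoint T ∧ spectrum ℂ T ⊆ Complex.ofReal '' Set.Icc A B) ↔
      0 ≤ T - (A : ℂ) • (1 : E →L[ℂ] E) ∧ 0 ≤ (B : ℂ) • (1 : E →L[ℂ] E) - T := by
  have hc : ∀ r : ℝ, algebraMap ℝ (E →L[ℂ] E) r = (r : ℂ) • (1 : E →L[ℂ] E) := fun r => by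
    rw [Algebra.algebraMap_eq_smul_one]; ext; simp
  have hsp : IsSelfAdjoint T → (spectrum ℂ T ⊆ Complex.ofReal '' Set.Icc A B ↔
      0 ≤ T - (A : ℂ) • (1 : E →L[ℂ] E) ∧ 0 ≤ (B : ℂ) • (1 : E →L[ℂ] E) - T) := fun hT => by
    -- For self-adjoint `T` the complex spectrum is the image of the real one, so both sides become
    -- bounds on real spectral values.
    rw [sub_nonneg, sub_nonneg, ← hc, ← hc, algebraMap_le_iff_le_spectrum hT,
      le_algebraMap_iff_spectrum_le hT, ← hT.spectrumRestricts.algebraMap_image]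
    change Complex.ofReal '' _ ⊆ _ ↔ _
    rw [Set.image_subset_image_iff Complex.ofReal_injective]
    exact ⟨fun h => ⟨fun x hx => (h hx).1, fun x hx => (h hx).2⟩,
      fun h x hx => ⟨h.1 x hx, h.2 x hx⟩⟩
  refine ⟨fun h => (hsp h.1).mp h.2, fun h => ?_⟩
  -- A nonnegative operator is self-adjoint, and adding back the real scalar A preserves this.
  have hT : IsSelfAdjoint T := by
    have h₁ := IsSelfAdjoint.of_nonneg h.1
    rw [← hc] at h₁
    simpa using h₁.add (IsSelfAdjoint.algebraMap (E →L[ℂ] E) (IsSelfAdjoint.all A))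
  exact ⟨hT, (hsp hT).mpr h⟩

/-! ### Range operators -/

section RangeOperators

variable {n : ℕ} {s : ℝ} {V : ClosedSubmodule ℂ (Sobolev n s)} {J : RangeFunction n s}
  {L : V.toSubmodule →L[ℂ] V.toSubmodule} {R : RangeOperator J}

/-- R(t) sends the dense sections to fibers of elements of V, and J(t) is closed. -/
theorem IsRangeOperatorOf.ae_mapsTo (hJ : IsRangeFunctionOf V J)
    (hR : IsRangeOperatorOf (V.toSubmodule.subtypeL ∘L L) R) :
    ∀ᵐ t ∂cellMeasure n, ∀ v : (J t).toSubmodule, R t v ∈ J t := by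
  obtain ⟨f, hf⟩ := hJ.exists_dense_sections
  filter_upwards [hf, ae_all_iff.mpr fun i => hR.2 (f i), ae_all_iff.mpr fun i => hJ.ae_mem (L (f i))]
    with t ⟨hm, hd⟩ hRf hLf v
  refine isClosed_property hd ((J t).isClosed.preimage (R t).continuous) (fun i => ?_) v
  obtain ⟨_, h⟩ := hRf i
  have hLi : fiber (L (f i) : Sobolev n s) t ∈ (J t).toSubmodule := hLf i
  have h' : fiber (L (f i) : Sobolev n s) t = R t ⟨fiber (f i : Sobolev n s) t, hm i⟩ := h
  rw [h'] at hLi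
  exact hLi

theorem RangeOperator.coe_onFiber_apply {t : Rn n} {v : (J t).toSubmodule} (h : R t v ∈ J t) :
    (R.onFiber t v : SeqSpace n s) = R t v :=
  Submodule.starProjection_eq_self_iff.mpr h

theorem IsRangeOperatorOf.actsFiberwise (hJ : IsRangeFunctionOf V J)
    (hR : IsRangeOperatorOf (V.toSubmodule.subtypeL ∘L L) R) :
    ActsFiberwise L R.onFiber := fun f => by
  filter_upwards [hR.2 f, hR.ae_mapsTo hJ] with t ⟨h, ht⟩ hmem
  exact ⟨h, ht.trans (RangeOperator.coe_onFiber_apply (hmem _)).symm⟩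

/-- A matrix coefficient of the adjoint field is a.e. the conjugate of one of R with `a` and `b`
exchanged. -/
theorem IsRangeOperatorOf.isMeasurable_adjoint (hJ : IsRangeFunctionOf V J)
    (hR : IsRangeOperatorOf (V.toSubmodule.subtypeL ∘L L) R) :
    RangeOperator.IsMeasurable (J := J) fun t =>
      (J t).toSubmodule.subtypeL ∘L ContinuousLinearMap.adjoint (R.onFiber t) := by
  intro a b
  refine (Complex.continuous_conj.measurable.comp_aemeasurable (hR.1 b a)).congr ?_
  filter_upwards [hR.ae_mapsTo hJ] with t hmem
  set P := (J t).toSubmodule.orthogonalProjectionOnto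
  calc (starRingEnd ℂ) (inner ℂ (R t (P b)) a)
      = inner ℂ a (R.onFiber t (P b) : SeqSpace n s) := by
        rw [inner_conj_symm, RangeOperator.coe_onFiber_apply (hmem _)]
    _ = inner ℂ (P a) (R.onFiber t (P b)) :=
        (Submodule.inner_orthogonalProjectionOnto_eq_of_mem_right _ _).symm
    _ = inner ℂ (ContinuousLinearMap.adjoint (R.onFiber t) (P a)) (P b) :=
        (ContinuousLinearMap.adjoint_inner_left _ _ _).symm
    _ = _ := Submodule.inner_orthogonalProjectionOnto_eq_of_mem_left _ _

end RangeOperators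

end SISobolev
end

theorem mainTheorem2 {n : ℕ} (hn : 1 ≤ n) (s : ℝ)
    (V : ClosedSubmodule ℂ (Sobolev n s)) (hV : IsShiftInvariant V)
    (J : RangeFunction n s) (hJ : IsRangeFunctionOf V J)
    (L : V.toSubmodule →L[ℂ] V.toSubmodule)
    (hL : IsShiftPreserving (V.toSubmodule.subtypeL ∘L L))
    (R : RangeOperator J) (hR : IsRangeOperatorOf (V.toSubmodule.subtypeL ∘L L) R) :
    -- `R(t)` is an operator on `J(t)` for a.e. `t`
    (∀ᵐ t ∂cellMeasure n, ∀ v : (J t).toSubmodule, R t v ∈ J t) ∧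
    -- `L*` is shift-preserving, with range operator `R(t)*`
    IsShiftPreserving (V.toSubmodule.subtypeL ∘L ContinuousLinearMap.adjoint L) ∧
    IsRangeOperatorOf (V.toSubmodule.subtypeL ∘L ContinuousLinearMap.adjoint L)
      (fun t => (J t).toSubmodule.subtypeL ∘L ContinuousLinearMap.adjoint (R.onFiber t)) ∧
    -- self-adjointness with spectrum in `[A, B]`
    (∀ A B : ℝ, A ≤ B →
      ((IsSelfAdjoint L ∧ spectrum ℂ L ⊆ Complex.ofReal '' Set.Icc A B) ↔
        ∀ᵐ t ∂cellMeasure n, IsSelfAdjoint (R.onFiber t) ∧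
          spectrum ℂ (R.onFiber t) ⊆ Complex.ofReal '' Set.Icc A B)) ∧
    -- unitarity
    (L ∈ unitary (V.toSubmodule →L[ℂ] V.toSubmodule) ↔
      ∀ᵐ t ∂cellMeasure n,
        R.onFiber t ∈ unitary ((J t).toSubmodule →L[ℂ] (J t).toSubmodule)) := by
  have hS := hR.actsFiberwise hJ
  refine ⟨hR.ae_mapsTo hJ, isShiftPreserving_adjoint hV hL,
    ⟨hR.isMeasurable_adjoint hJ, hS.adjoint hJ⟩, fun A B _ => ?_, hS.mem_unitary_iff hJ⟩
  -- The identity acts fiberwise, hence so do L - A and B - L, to which the positivity criterion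
  -- applies.
  have h1 := ActsFiberwise.one hJ
  simp only [ContinuousLinearMap.isSelfAdjoint_and_spectrum_subset_iff, Filter.eventually_and]
  exact and_congr ((hS.sub (h1.smul A)).nonneg_iff hJ) (((h1.smul B).sub hS).nonneg_iff hJ)
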